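/- Proposition. Let $m\ge 1$, and let $H=\{z\in\mathbb{C}^3 : z_1^2+z_2^2=z_3^{m+1}+\tfrac12\}$, equipped with the restriction $\omega$ of the standard symplectic form of $\mathbb{C}^3$; this is a smooth symplectic manifold of real dimension four. An $(A_k)$-configuration in a symplectic four-manifold consists of $k$ embedded Lagrangian two-spheres $L_1,\dots,L_k$, any two of which intersect transversely, with $|L_i\cap L_j|=1$ if $|i-j|=1$ and $L_i\cap L_j=\emptyset$ if $|i-j|\ge 2$. (1) $(H,\omega)$ contains an $(A_m)$-configuration of Lagrangian two-spheres. More precisely, let $S^2\subset\mathbb{R}^3$ be the unit sphere, let $\pi:H\to\mathbb{C}^2$ be the branched covering $\pi(z)=(z_1,z_2)$, let $\sigma(z_1,z_2,z_3)=(z_1,z_2,e^{2\pi i/(m+1)}z_3)$, and let $$f:S^2\to\mathbb{C}^2,\qquad f(t_1,t_2,t_3)=(t_2(1+it_1),\,t_3(1+it_1)),$$ be the figure-eight map, which is a Lagrangian immersion for the standard symplectic form on $\mathbb{C}^2$. Then there is a lift $\tilde f:S^2\to H$, $\pi\circ\tilde f=f$, such that the images of the maps $\tilde f,\ \sigma\circ\tilde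 f,\ \dots,\ \sigma^{m-1}\circ\tilde f$, which are smooth embeddings, form an $(A_m)$-configuration of Lagrangian two-spheres in $(H,\omega)$. (2) If $m\ge 3$, then there is an $R_0$ such that for every $R\ge R_0$ the bounded domain $M=\{z\in H : |z|<R\}$ has the following properties: it is the interior of a compact symplectic manifold with contact type boundary (namely of its closure in $H$, which is a compact domain with smooth boundary, such that near the boundary $\omega$ has a primitive whose Liouville vector field points outward along the boundary); it contains an $(A_3)$-configuration of Lagrangian two-spheres; and both $[\omega]\in H^2(M;\mathbb{R})$ and $c_1(M,\omega)\in H^2(M;\mathbb{Z})$ vanish. -/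

import Mathlib

open scoped Manifold ContDiff
open Module

noncomputable section

/-- The unit two-sphere in `ℝ³`, with Mathlib's smooth structure. -/
abbrev S2 : Type := Metric.sphere (0 : EuclideanSpace ℝ (Fin 3)) 1

instance finrankEuclideanThree : Fact (finrank ℝ (EuclideanSpace ℝ (Fin 3)) = 2 + 1) :=
  ⟨by simp⟩

/-- `ℂⁿ` with its Euclidean norm. -/
abbrev Cn (n : ℕ) : Type := EuclideanSpace ℂ (Fin n)

/-- The standard symplectic form `∑ dxⱼ ∧ dyⱼ` on `ℂⁿ`. -/
def stdForm {n : ℕ} (u v : Cn n) : ℝ :=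
  ∑ j, ((u j).re * (v j).im - (u j).im * (v j).re)

/-- The polynomial `z₁² + z₂² - z₃^(m+1) - 1/2`. -/
def hyperPoly (m : ℕ) (z : Cn 3) : ℂ :=
  z 0 ^ 2 + z 1 ^ 2 - z 2 ^ (m + 1) - 1 / 2

/-- The affine hypersurface `H`: `z₁² + z₂² = z₃^(m+1) + 1/2`. -/
def hypersurface (m : ℕ) : Set (Cn 3) :=
  {z | z 0 ^ 2 + z 1 ^ 2 = z 2 ^ (m + 1) + 1 / 2}

/-- The tangent space of `H` at `z`, the kernel of the differential of its defining polynomial.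
It is a complex subspace of `ℂ³`. -/
def hyperTangent (m : ℕ) (z : Cn 3) : Submodule ℂ (Cn 3) :=
  LinearMap.ker (fderiv ℂ (hyperPoly m) z : Cn 3 →ₗ[ℂ] ℂ)

/-- `(H, ω)` is a smooth symplectic manifold of real dimension four: the defining polynomial is
regular along `H`, the tangent spaces have real dimension four, and the standard form (which is
closed, having constant coefficients) is nondegenerate on them. -/
structure IsSymplecticHypersurface (m : ℕ) : Prop where
  regular : ∀ z ∈ hypersurface m, fderiv ℂ (hyperPoly m) z ≠ 0
  dimension : ∀ z ∈ hypersurface m, finrank ℝ (hyperTangent m z) = 4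
  nondegenerate : ∀ z ∈ hypersurface m, ∀ u ∈ hyperTangent m z,
    (∀ v ∈ hyperTangent m z, stdForm u v = 0) → u = 0

/-- A smooth immersion of the two-sphere in `ℂⁿ` along which the standard form vanishes.
An immersion of this kind whose image lies in a four-dimensional symplectic submanifold
is a Lagrangian immersion into that submanifold. -/
structure IsIsotropicImmersion {n : ℕ} (f : S2 → Cn n) : Prop where
  smooth : ContMDiff (𝓡 2) 𝓘(ℝ, Cn n) ∞ f
  immersion : ∀ t : S2, Function.Injective (mfderiv (𝓡 2) 𝓘(ℝ, Cn n) f t)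
  isotropic : ∀ (t : S2) (u v : TangentSpace (𝓡 2) t),
    stdForm (n := n) (mfderiv (𝓡 2) 𝓘(ℝ, Cn n) f t u) (mfderiv (𝓡 2) 𝓘(ℝ, Cn n) f t v) = 0

/-- `f` is an embedding of the two-sphere onto a Lagrangian submanifold of `M`, where `M` is an
open subset of `H`. -/
structure IsLagrangianSphere (M : Set (Cn 3)) (f : S2 → Cn 3) : Prop
    extends IsIsotropicImmersion f where
  injective : Function.Injective f
  mem : ∀ t, f t ∈ M

/-- The tangent space to an immersed sphere in `ℂ³`, at the parameter `t`. -/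
def sphereTangent (f : S2 → Cn 3) (t : S2) : Submodule ℝ (Cn 3) :=
  LinearMap.range (mfderiv (𝓡 2) 𝓘(ℝ, Cn 3) f t).toLinearMap

/-- The spheres `L₀ = range (f 0), …, L_{k-1} = range (f (k-1))` are an `(A_k)`-configuration of
Lagrangian two-spheres in `M`, where `M` is an open subset of `H`. -/
structure IsAConfiguration (m : ℕ) (M : Set (Cn 3)) {k : ℕ} (f : Fin k → S2 → Cn 3) : Prop where
  lagrangian : ∀ i, IsLagrangianSphere M (f i)
  transverse : ∀ i j, i ≠ j → ∀ s t : S2, f i s = f j t →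
    sphereTangent (f i) s ⊔ sphereTangent (f j) t = (hyperTangent m (f i s)).restrictScalars ℝ
  adjacent : ∀ i j : Fin k, ((i : ℕ) + 1 = j ∨ (j : ℕ) + 1 = i) →
    (Set.range (f i) ∩ Set.range (f j)).ncard = 1
  distant : ∀ i j : Fin k, ((i : ℕ) + 2 ≤ j ∨ (j : ℕ) + 2 ≤ i) →
    Set.range (f i) ∩ Set.range (f j) = ∅

/-- The figure-eight map `(t₁, t₂, t₃) ↦ (t₂ (1 + i t₁), t₃ (1 + i t₁))`. -/
def figureEight (t : S2) : Cn 2 :=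
  !₂[((t : EuclideanSpace ℝ (Fin 3)) 1 : ℂ) *
        (1 + Complex.I * ((t : EuclideanSpace ℝ (Fin 3)) 0 : ℂ)),
     ((t : EuclideanSpace ℝ (Fin 3)) 2 : ℂ) *
        (1 + Complex.I * ((t : EuclideanSpace ℝ (Fin 3)) 0 : ℂ))]

/-- The projection `(z₁, z₂, z₃) ↦ (z₁, z₂)`; on `H` it is the branched covering. -/
def branchedCover (z : Cn 3) : Cn 2 := !₂[z 0, z 1]

/-- The generator `(z₁, z₂, z₃) ↦ (z₁, z₂, e^{2πi/(m+1)} z₃)` of the covering group. -/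
def deckMap (m : ℕ) (z : Cn 3) : Cn 3 :=
  !₂[z 0, z 1, Complex.exp (2 * Real.pi * Complex.I / (m + 1)) * z 2]

/-- The bounded domain `{z ∈ H : |z| < R}`. -/
def boundedDomain (m : ℕ) (R : ℝ) : Set (Cn 3) :=
  {z | ‖z‖ < R ∧ z ∈ hypersurface m}

/-- The smooth one-form `α`, defined near the part `A` of `H`, is a primitive of `ω` along `A`:
`dα = ω` on all pairs of vectors tangent to `H`. -/
def IsPrimitiveOn (m : ℕ) (A : Set (Cn 3)) (α : Cn 3 → Cn 3 [⋀^Fin 1]→L[ℝ] ℝ) : Prop :=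
  ∀ z ∈ A, ∀ u ∈ hyperTangent m z, ∀ v ∈ hyperTangent m z,
    extDeriv α z ![u, v] = stdForm u v

/-- The class of `ω` in the second de Rham cohomology of `M` (an open subset of `H`) is zero.
One-forms on `M` are written as restrictions of smooth one-forms on an open subset of `ℂ³`. -/
def SymplecticClassVanishes (m : ℕ) (M : Set (Cn 3)) : Prop :=
  ∃ (U : Set (Cn 3)) (α : Cn 3 → Cn 3 [⋀^Fin 1]→L[ℝ] ℝ),
    IsOpen U ∧ M ⊆ U ∧ ContDiffOn ℝ ∞ α U ∧ IsPrimitiveOn m M α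

/-- `M` is the interior of a compact domain with smooth boundary in `H` (the closure of `M`), and
the boundary is of contact type: `ω` has a primitive `α` on a neighbourhood of the boundary in
the domain, such that the Liouville vector field `X`, given by `ω (X, ·) = α`, points outward
along the boundary. Here `ρ` is a boundary defining function. -/
def IsInteriorOfContactTypeDomain (m : ℕ) (M : Set (Cn 3)) : Prop :=
  IsCompact (closure M) ∧
  ∃ ρ : Cn 3 → ℝ, ContDiff ℝ ∞ ρ ∧
    M = {z | z ∈ hypersurface m ∧ ρ z < 0} ∧
    closure M = {z | z ∈ hypersurface m ∧ ρ z ≤ 0} ∧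
    (∀ z ∈ hypersurface m, ρ z = 0 → ∃ v ∈ hyperTangent m z, fderiv ℝ ρ z v ≠ 0) ∧
    ∃ (U : Set (Cn 3)) (α : Cn 3 → Cn 3 [⋀^Fin 1]→L[ℝ] ℝ),
      IsOpen U ∧ {z | z ∈ hypersurface m ∧ ρ z = 0} ⊆ U ∧ ContDiffOn ℝ ∞ α U ∧
      IsPrimitiveOn m (U ∩ closure M) α ∧
      ∀ z ∈ hypersurface m, ρ z = 0 →
        ∃ X ∈ hyperTangent m z,
          (∀ v ∈ hyperTangent m z, stdForm X v = α z ![v]) ∧ 0 < fderiv ℝ ρ z X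

/-- Multiplication by `i` on `ℂⁿ`, hence on the complex subspaces `hyperTangent m z`, is a complex
structure compatible with the standard form: it preserves the form ... -/
theorem stdForm_I_smul {n : ℕ} (u v : Cn n) :
    stdForm (Complex.I • u) (Complex.I • v) = stdForm u v := by
  unfold stdForm
  refine Finset.sum_congr rfl fun j _ => ?_
  simp
  ring

/-- ... and tames it. -/
theorem stdForm_I_smul_pos {n : ℕ} (v : Cn n) (hv : v ≠ 0) :
    0 < stdForm v (Complex.I • v) := by
  have h : stdForm v (Complex.I • v) = ‖v‖ ^ 2 := by
    rw [EuclideanSpace.norm_sq_eq]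
    unfold stdForm
    refine Finset.sum_congr rfl fun j _ => ?_
    rw [Complex.sq_norm, Complex.normSq_apply]
    simp
  rw [h]
  have := norm_pos_iff.mpr hv
  positivity

/-- The first Chern class of `(M, ω)`, for `M` an open subset of `H`, vanishes in `H²(M; ℤ)`.
It is the first Chern class of `TM` with the compatible complex structure `i`, as a Čech class:
take local complex frames `e i` of `TM` over an open cover `U i`, with transition matrices `g i j`,
and choose logarithms `f i j` of their determinants, `det (g i j) = exp (2πi f i j)`. Then
the integers `f i j + f j k - f i k` are a Čech two-cocycle which represents the class up to sign.
It vanishes if, for a sufficiently fine cover, this cocycle is the coboundary of a one-cochain `n`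
of locally constant integer-valued functions. -/
def FirstChernClassVanishes (m : ℕ) (M : Set (Cn 3)) : Prop :=
  ∃ (ι : Type) (U : ι → Set (Cn 3)) (e : ι → Fin 2 → Cn 3 → Cn 3)
    (g : ι → ι → Cn 3 → Matrix (Fin 2) (Fin 2) ℂ) (f : ι → ι → Cn 3 → ℂ)
    (n : ι → ι → Cn 3 → ℤ),
    (∀ i, IsOpen (U i)) ∧ (M ⊆ ⋃ i, U i) ∧
    (∀ i a, ContinuousOn (e i a) (U i ∩ M)) ∧
    (∀ i, ∀ z ∈ U i ∩ M,
      (∀ a, e i a z ∈ hyperTangent m z) ∧ LinearIndependent ℂ (fun a => e i a z)) ∧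
    (∀ i j, ∀ z ∈ U i ∩ U j ∩ M, ∀ b, e j b z = ∑ a, g i j z a b • e i a z) ∧
    (∀ i j, ContinuousOn (f i j) (U i ∩ U j ∩ M)) ∧
    (∀ i j, ∀ z ∈ U i ∩ U j ∩ M,
      (g i j z).det = Complex.exp (2 * Real.pi * Complex.I * f i j z)) ∧
    (∀ i j, ContinuousOn (n i j) (U i ∩ U j ∩ M)) ∧
    (∀ i j k, ∀ z ∈ U i ∩ U j ∩ U k ∩ M,
      f i j z + f j k z - f i k z = (n i j z + n j k z - n i k z : ℤ))

/-- `(M, ω)`, for `M` an open subset of `H`, is the interior of a compact symplectic manifold with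
contact type boundary, contains an `(A₃)`-configuration of Lagrangian two-spheres, and has
`[ω] = 0` and `c₁(M, ω) = 0`. -/
structure SatisfiesKnottingHypotheses (m : ℕ) (M : Set (Cn 3)) : Prop where
  contactType : IsInteriorOfContactTypeDomain m M
  configuration : ∃ f : Fin 3 → S2 → Cn 3, IsAConfiguration m M f
  symplecticClass : SymplecticClassVanishes m M
  chernClass : FirstChernClassVanishes m M

end

/-!
The standard form has the linear primitive `½ ∑ (xⱼ dyⱼ - yⱼ dxⱼ)`, so `[ω] = 0`. The Liouville
field of its restriction to `H` is half the orthogonal projection of `z` to the tangent space. It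
points outward along `|z| = R` unless `z` is orthogonal to the tangent space, and Euler's identity
bounds such points of `H` by `|z|² ≤ m + 1`.

Contracting the holomorphic volume form of `ℂ³` with `dP`, where `H = {P = 0}`, trivialises `Λ²TH`:
where `∂ᵢP ≠ 0`, the tangent planes have a frame whose cross product is the gradient of `P`, and two
such frames differ by a matrix of determinant one. Hence `c₁ = 0`.

Along the figure-eight map, `z₃ ^ (m + 1)` has to be the loop `(1 - s²)(1 + i s)² - ½` in `s = t₁`.
It avoids the origin and winds once around it as `s` runs through `[-1, 1]`, so it has a smooth
`(m + 1)`-st root `h` on `[-1, 1]`, with `h 1 = exp (2πi / (m + 1)) * h (-1)`. The figure-eight map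
identifies no two points except the poles `s = ±1`, so the `k`-th and `l`-th rotated spheres can
meet only over the poles, and they do so exactly when `|k - l| = 1`. The two tangent planes there
project to `(1 + i)ℝ²` and `(1 - i)ℝ²`, which are transverse.
-/

section StandardForm

theorem stdForm_eq_im_inner {n : ℕ} (u v : Cn n) : stdForm u v = (inner ℂ u v).im := by
  simp only [stdForm, PiLp.inner_apply, Complex.im_sum, RCLike.inner_apply, Complex.mul_im,
    Complex.conj_re, Complex.conj_im]
  exact Finset.sum_congr rfl fun j _ => by ring

theorem stdForm_antisymm {n : ℕ} (u v : Cn n) : stdForm u v = -stdForm v u := by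
  rw [stdForm_eq_im_inner, stdForm_eq_im_inner, ← inner_conj_symm, Complex.conj_im]

theorem extDeriv_continuousLinearMap {𝕜 E F : Type*} [NontriviallyNormedField 𝕜]
    [NormedAddCommGroup E] [NormedSpace 𝕜 E] [NormedAddCommGroup F] [NormedSpace 𝕜 F]
    (α : E →L[𝕜] E [⋀^Fin 1]→L[𝕜] F) (x u v : E) :
    extDeriv α x ![u, v] = α u ![v] - α v ![u] := by
  have remove_zero : (0 : Fin 2).removeNth ![u, v] = ![v] := by ext i; fin_cases i; rfl
  have remove_one : (1 : Fin 2).removeNth ![u, v] = ![u] := by ext i; fin_cases i; rfl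
  rw [extDeriv, ContinuousLinearMap.fderiv, ContinuousAlternatingMap.alternatizeUncurryFin_apply,
    Fin.sum_univ_two, remove_zero, remove_one]
  simp [sub_eq_add_neg]

/-- The primitive `½ ∑ (xⱼ dyⱼ - yⱼ dxⱼ)` of the standard form. Its coefficients are linear in the
base point, so it is encoded as a linear map from points to one-forms. -/
noncomputable def stdPrimitive (n : ℕ) : Cn n →L[ℝ] Cn n [⋀^Fin 1]→L[ℝ] ℝ :=
  LinearMap.toContinuousLinearMap
    { toFun := fun z => ContinuousAlternatingMap.ofSubsingleton ℝ (Cn n) ℝ (0 : Fin 1)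
        ((1 / 2 : ℝ) • Complex.imCLM ∘L (innerSL ℂ z).restrictScalars ℝ)
      map_add' := fun z w => by ext v; simp
      map_smul' := fun c z => by ext v; simp [inner_smul_left_eq_smul, mul_left_comm] }

theorem stdPrimitive_apply {n : ℕ} (z v : Cn n) : stdPrimitive n z ![v] = stdForm z v / 2 := by
  simp [stdPrimitive, stdForm_eq_im_inner, div_eq_inv_mul]

theorem extDeriv_stdPrimitive {n : ℕ} (z u v : Cn n) :
    extDeriv (stdPrimitive n) z ![u, v] = stdForm u v := by
  rw [extDeriv_continuousLinearMap, stdPrimitive_apply, stdPrimitive_apply, stdForm_antisymm v u]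
  ring

theorem isPrimitiveOn_stdPrimitive (m : ℕ) (A : Set (Cn 3)) : IsPrimitiveOn m A (stdPrimitive 3) :=
  fun z _ u _ v _ => extDeriv_stdPrimitive z u v

theorem symplecticClassVanishes (m : ℕ) (M : Set (Cn 3)) : SymplecticClassVanishes m M :=
  ⟨Set.univ, stdPrimitive 3, isOpen_univ, Set.subset_univ _, (stdPrimitive 3).contDiff.contDiffOn,
    isPrimitiveOn_stdPrimitive m M⟩

theorem exists_liouvilleVector {n : ℕ} {T : Submodule ℂ (Cn n)} {z : Cn n} (hz : z ∉ Tᗮ) :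
    ∃ X ∈ T, (∀ v ∈ T, stdForm X v = stdPrimitive n z ![v]) ∧ 0 < inner ℝ z X := by
  set P := T.starProjection z
  have hP : P ∈ T := T.starProjection_apply_mem z
  have inner_P (v : Cn n) (hv : v ∈ T) : inner ℂ P v = inner ℂ z v := by
    rw [Submodule.inner_starProjection_left_eq_right, Submodule.starProjection_eq_self_iff.2 hv]
  have P_ne_zero : P ≠ 0 := fun h => hz ((Submodule.starProjection_apply_eq_zero_iff T).1 h)
  refine ⟨(1 / 2 : ℝ) • P, T.smul_of_tower_mem _ hP, fun v hv => ?_, ?_⟩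
  · rw [stdPrimitive_apply, stdForm_eq_im_inner, stdForm_eq_im_inner,
      inner_smul_left_eq_smul, inner_P v hv]
    simp [div_eq_inv_mul]
  · have inner_self : inner ℝ z P = ‖P‖ ^ 2 := by
      have re_inner : inner ℝ z P = (inner ℂ z P).re := by simp [PiLp.inner_apply, Complex.inner]
      rw [re_inner, ← inner_P P hP]
      exact inner_self_eq_norm_sq (𝕜 := ℂ) P
    rw [inner_smul_right, inner_self]
    have := norm_pos_iff.2 P_ne_zero
    positivity

end StandardForm

section Hypersurface

variable {m : ℕ} {z : Cn 3}

/-- The partial derivatives of the defining polynomial of `H`. They are a plain function on `Fin 3`,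
so that the cross product of Mathlib applies to them. -/
noncomputable def hyperPartial (m : ℕ) (z : Cn 3) : Fin 3 → ℂ :=
  ![2 * z 0, 2 * z 1, -((m + 1) * z 2 ^ m)]

theorem continuous_hyperPartial (m : ℕ) : Continuous (hyperPartial m) := by
  refine continuous_pi fun i => ?_
  fin_cases i <;> simp only [hyperPartial] <;> fun_prop

theorem hasStrictFDerivAt_hyperPoly (m : ℕ) (z : Cn 3) :
    HasStrictFDerivAt (hyperPoly m)
      (∑ j, hyperPartial m z j • (EuclideanSpace.proj j : Cn 3 →L[ℂ] ℂ)) z := by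
  have coord (j : Fin 3) :
      HasStrictFDerivAt (fun w : Cn 3 => w j) (EuclideanSpace.proj j : Cn 3 →L[ℂ] ℂ) z :=
    (EuclideanSpace.proj j : Cn 3 →L[ℂ] ℂ).hasStrictFDerivAt
  refine (((((coord 0).pow 2).add ((coord 1).pow 2)).sub
    ((coord 2).pow (m + 1))).sub_const (1 / 2)).congr_fderiv ?_
  ext v
  simp only [add_tsub_cancel_right, nsmul_eq_mul, Nat.cast_add, Nat.cast_one, Nat.cast_ofNat,
    add_apply, sub_apply, smul_apply, smul_eq_mul, PiLp.proj_apply, hyperPartial,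
    Fin.sum_univ_three, Matrix.cons_val]
  ring

theorem fderiv_hyperPoly_apply (m : ℕ) (z v : Cn 3) :
    fderiv ℂ (hyperPoly m) z v = ∑ j, hyperPartial m z j * v j := by
  simp [(hasStrictFDerivAt_hyperPoly m z).hasFDerivAt.fderiv]

theorem mem_hyperTangent_iff {v : Cn 3} :
    v ∈ hyperTangent m z ↔ ∑ j, hyperPartial m z j * v j = 0 := by
  rw [← fderiv_hyperPoly_apply]
  exact LinearMap.mem_ker

theorem mem_orthogonal_hyperTangent_iff {w : Cn 3} :
    w ∈ (hyperTangent m z)ᗮ ↔ ∃ c : ℂ, ∀ j, w j = c * starRingEnd ℂ (hyperPartial m z j) := by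
  set grad : Cn 3 := WithLp.toLp 2 fun j => starRingEnd ℂ (hyperPartial m z j)
  have tangent_eq : hyperTangent m z = (ℂ ∙ grad)ᗮ := by
    ext v
    rw [Submodule.mem_orthogonal_singleton_iff_inner_right, mem_hyperTangent_iff]
    simp [grad, PiLp.inner_apply, mul_comm]
  rw [tangent_eq, Submodule.orthogonal_orthogonal, Submodule.mem_span_singleton]
  exact exists_congr fun c => by simp [PiLp.ext_iff, grad, eq_comm]

theorem hyperPoly_eq_zero_iff : hyperPoly m z = 0 ↔ z ∈ hypersurface m := by
  rw [hyperPoly, sub_sub, sub_eq_zero]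
  rfl

theorem hyperPartial_ne_zero (hz : z ∈ hypersurface m) : hyperPartial m z ≠ 0 := by
  intro h
  have z0 : z 0 = 0 := by simpa [hyperPartial] using congrFun h 0
  have z1 : z 1 = 0 := by simpa [hyperPartial] using congrFun h 1
  have z2 : z 2 ^ m = 0 := by
    simpa [hyperPartial, Nat.cast_add_one_ne_zero] using congrFun h 2
  have : z 0 ^ 2 + z 1 ^ 2 = z 2 ^ (m + 1) + 1 / 2 := hz
  rw [z0, z1, pow_succ (z 2), z2] at this
  norm_num at this

theorem fderiv_hyperPoly_ne_zero (hz : z ∈ hypersurface m) : fderiv ℂ (hyperPoly m) z ≠ 0 := by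
  obtain ⟨j, hj⟩ := Function.ne_iff.1 (hyperPartial_ne_zero hz)
  refine fun h => hj ?_
  simpa [h] using (fderiv_hyperPoly_apply m z (EuclideanSpace.single j 1)).symm

theorem isSymplecticHypersurface (m : ℕ) : IsSymplecticHypersurface m where
  regular _ := fderiv_hyperPoly_ne_zero
  dimension z hz := by
    have rank_nullity := Module.Dual.finrank_ker_add_one_of_ne_zero
      (f := (fderiv ℂ (hyperPoly m) z : Cn 3 →ₗ[ℂ] ℂ))
      fun h => fderiv_hyperPoly_ne_zero hz (ContinuousLinearMap.coe_injective h)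
    rw [finrank_euclideanSpace_fin] at rank_nullity
    rw [finrank_real_of_complex, hyperTangent]
    exact congrArg (2 * ·) (Nat.succ_injective rank_nullity)
  nondegenerate z _ u hu h := by
    by_contra u_ne_zero
    exact (stdForm_I_smul_pos u u_ne_zero).ne' (h _ (Submodule.smul_mem _ _ hu))

theorem isClosed_hypersurface (m : ℕ) : IsClosed (hypersurface m) :=
  isClosed_eq (by fun_prop) (by fun_prop)

end Hypersurface

section ContactBoundary

variable {m : ℕ} {z : Cn 3} {R : ℝ}

theorem norm_eq_half_of_eq_mul_conj {c w : ℂ} (hw : w ≠ 0) (h : w = c * starRingEnd ℂ (2 * w)) :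
    ‖c‖ = 1 / 2 := by
  have norm_eq := congrArg norm h
  rw [norm_mul, RCLike.norm_conj, norm_mul, Complex.norm_ofNat] at norm_eq
  have := norm_pos_iff.2 hw
  field_simp
  nlinarith

-- Euler's identity `z₀ ∂₀/2 + z₁ ∂₁/2 + z₂ ∂₂/(m+1) = 1/2` on `H`, where `zⱼ ∂ⱼ = c |∂ⱼ|²`.
theorem weighted_norm_sq_of_normal {c : ℂ} (hz : z ∈ hypersurface m)
    (hc : ∀ j, z j = c * starRingEnd ℂ (hyperPartial m z j)) :
    ‖c‖ * (2 * ‖z 0‖ ^ 2 + 2 * ‖z 1‖ ^ 2 + (m + 1) * ‖z 2 ^ m‖ ^ 2) = 1 / 2 := by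
  have euler : c * (2 * ‖z 0‖ ^ 2 + 2 * ‖z 1‖ ^ 2 + (m + 1) * ‖z 2 ^ m‖ ^ 2 : ℝ) = 1 / 2 := by
    have heq : z 0 ^ 2 + z 1 ^ 2 = z 2 ^ (m + 1) + 1 / 2 := hz
    have h0 := hc 0
    have h1 := hc 1
    have h2 := hc 2
    simp only [hyperPartial, Matrix.cons_val, map_mul, map_neg, map_add, map_one, map_natCast,
      map_ofNat] at h0 h1 h2
    push_cast
    rw [← Complex.mul_conj', ← Complex.mul_conj', ← Complex.mul_conj']
    linear_combination heq - z 0 * h0 - z 1 * h1 + z 2 ^ m * h2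
  have norm_euler := congrArg norm euler
  rw [norm_mul, Complex.norm_of_nonneg (by positivity)] at norm_euler
  simpa using norm_euler

theorem norm_sq_le_of_mem_orthogonal_hyperTangent (hz : z ∈ hypersurface m)
    (hperp : z ∈ (hyperTangent m z)ᗮ) : ‖z‖ ^ 2 ≤ m + 1 := by
  obtain ⟨c, hc⟩ := mem_orthogonal_hyperTangent_iff.1 hperp
  rw [EuclideanSpace.norm_sq_eq, Fin.sum_univ_three]
  by_cases hne : z 0 = 0 ∧ z 1 = 0
  · have pow_eq : z 2 ^ (m + 1) = -(1 / 2) := by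
      have heq : z 0 ^ 2 + z 1 ^ 2 = z 2 ^ (m + 1) + 1 / 2 := hz
      rw [hne.1, hne.2] at heq
      linear_combination -heq
    have norm_z2 : ‖z 2‖ ≤ 1 := by
      rw [← pow_le_one_iff_of_nonneg (norm_nonneg _) m.succ_ne_zero, ← norm_pow, pow_eq]
      norm_num
    rw [hne.1, hne.2, norm_zero]
    nlinarith [norm_nonneg (z 2), (m.cast_nonneg : (0 : ℝ) ≤ m)]
  · have norm_c : ‖c‖ = 1 / 2 := by
      by_cases h0 : z 0 = 0
      · exact norm_eq_half_of_eq_mul_conj (fun h1 => hne ⟨h0, h1⟩) (hc 1)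
      · exact norm_eq_half_of_eq_mul_conj h0 (hc 0)
    have norm_z2 : ‖z 2‖ = (m + 1) / 2 * ‖z 2 ^ m‖ := by
      have norm_succ : ‖(m : ℂ) + 1‖ = m + 1 := by exact_mod_cast Complex.norm_natCast (m + 1)
      have norm_eq : ‖z 2‖ = ‖c‖ * ‖-((m + 1) * z 2 ^ m)‖ := by
        conv_lhs => rw [hc 2, norm_mul, RCLike.norm_conj]
        rfl
      rw [norm_eq, norm_neg, norm_mul, norm_succ, norm_c]
      ring
    have weighted := weighted_norm_sq_of_normal hz hc
    rw [norm_c] at weighted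
    rw [norm_z2]
    nlinarith [sq_nonneg ‖z 0‖, sq_nonneg ‖z 1‖, (m.cast_nonneg : (0 : ℝ) ≤ m)]

theorem mem_closure_setOf_lt_of_hasStrictFDerivAt {E F : Type*} [NormedAddCommGroup E]
    [NormedSpace ℝ E] [CompleteSpace E] [NormedAddCommGroup F] [NormedSpace ℝ F] [CompleteSpace F]
    {p : E → F} {p' : E →L[ℝ] F} {ρ : E → ℝ} {ρ' : E →L[ℝ] ℝ} {x v : E}
    (hp : HasStrictFDerivAt p p' x) (hρ : HasStrictFDerivAt ρ ρ' x)
    (hsurj : Function.Surjective p') (hv : p' v = 0) (hρv : ρ' v ≠ 0) :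
    x ∈ closure {y | p y = p x ∧ ρ y < ρ x} := by
  have hrange : (p'.prod ρ' : E →ₗ[ℝ] F × ℝ).range = ⊤ := by
    rw [LinearMap.range_eq_top]
    rintro ⟨a, b⟩
    obtain ⟨u, hu⟩ := hsurj a
    exact ⟨u + ((b - ρ' u) / ρ' v) • v, by simp [hu, hv, hρv]⟩
  have hvalue : (p x, ρ x) ∈ closure ({p x} ×ˢ Set.Iio (ρ x)) := by simp [closure_prod_eq]
  rw [mem_closure_iff_frequently, ← (hp.prodMk hρ).map_nhds_eq_of_surj hrange,
    Filter.frequently_map] at hvalue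
  exact mem_closure_iff_frequently.2 hvalue

theorem exists_outward_liouvilleVector (hz : z ∈ hypersurface m) (hR : m + 1 < ‖z‖ ^ 2) (c : ℝ) :
    ∃ X ∈ hyperTangent m z, (∀ v ∈ hyperTangent m z, stdForm X v = stdPrimitive 3 z ![v]) ∧
      0 < fderiv ℝ (fun w : Cn 3 => ‖w‖ ^ 2 - c) z X := by
  obtain ⟨X, hX, liouville, outward⟩ := exists_liouvilleVector fun hperp =>
    (norm_sq_le_of_mem_orthogonal_hyperTangent hz hperp).not_gt hR
  refine ⟨X, hX, liouville, ?_⟩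
  rw [fderiv_sub_const, fderiv_norm_sq_apply]
  simpa using outward

theorem boundedDomain_eq (hR : 0 ≤ R) :
    boundedDomain m R = {z | z ∈ hypersurface m ∧ ‖z‖ ^ 2 - R ^ 2 < 0} := by
  ext z
  simp only [boundedDomain, Set.mem_ofPred_eq, sub_neg, sq_lt_sq₀ (norm_nonneg z) hR]
  exact and_comm

theorem mem_closure_boundedDomain (hR : 0 ≤ R) (hmR : m + 1 < R ^ 2) (hz : z ∈ hypersurface m)
    (hzR : ‖z‖ ^ 2 - R ^ 2 = 0) : z ∈ closure (boundedDomain m R) := by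
  obtain ⟨X, hX, -, outward⟩ := exists_outward_liouvilleVector hz (by linarith) (R ^ 2)
  have hp : HasStrictFDerivAt (hyperPoly m) ((fderiv ℂ (hyperPoly m) z).restrictScalars ℝ) z :=
    (hasStrictFDerivAt_hyperPoly m z).hasFDerivAt.fderiv ▸
      (hasStrictFDerivAt_hyperPoly m z).restrictScalars ℝ
  have hρ : ContDiff ℝ 1 fun w : Cn 3 => ‖w‖ ^ 2 - R ^ 2 := (contDiff_norm_sq ℝ).sub contDiff_const
  have hsurj : Function.Surjective (fderiv ℂ (hyperPoly m) z) :=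
    LinearMap.surjective (f := (fderiv ℂ (hyperPoly m) z : Cn 3 →ₗ[ℂ] ℂ)) fun h =>
      fderiv_hyperPoly_ne_zero hz (ContinuousLinearMap.coe_injective h)
  have := mem_closure_setOf_lt_of_hasStrictFDerivAt hp
    (hρ.contDiffAt.hasStrictFDerivAt one_ne_zero) hsurj hX outward.ne'
  simpa only [boundedDomain_eq hR, hzR, hyperPoly_eq_zero_iff.2 hz, hyperPoly_eq_zero_iff]
    using this

theorem closure_boundedDomain (hR : 0 ≤ R) (hmR : m + 1 < R ^ 2) :
    closure (boundedDomain m R) = {z | z ∈ hypersurface m ∧ ‖z‖ ^ 2 - R ^ 2 ≤ 0} := by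
  refine subset_antisymm (closure_minimal ?_ ?_) ?_
  · rw [boundedDomain_eq hR]
    exact fun z hz => ⟨hz.1, hz.2.le⟩
  · exact (isClosed_hypersurface m).inter
      (isClosed_le (f := fun z : Cn 3 => ‖z‖ ^ 2 - R ^ 2) (by fun_prop) continuous_const)
  · rintro z ⟨hz, hzR⟩
    rcases hzR.lt_or_eq with inside | boundary
    · exact subset_closure ((boundedDomain_eq hR).symm ▸ ⟨hz, inside⟩)
    · exact mem_closure_boundedDomain hR hmR hz boundary

theorem isInteriorOfContactTypeDomain_boundedDomain (hR : 0 ≤ R) (hmR : m + 1 < R ^ 2) :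
    IsInteriorOfContactTypeDomain m (boundedDomain m R) := by
  have liouville (z : Cn 3) (hz : z ∈ hypersurface m) (hzR : ‖z‖ ^ 2 - R ^ 2 = 0) :=
    exists_outward_liouvilleVector hz (by linarith) (R ^ 2)
  refine ⟨?_, fun z => ‖z‖ ^ 2 - R ^ 2, (contDiff_norm_sq ℝ).sub contDiff_const,
    boundedDomain_eq hR, closure_boundedDomain hR hmR, fun z hz hzR => ?_,
    Set.univ, stdPrimitive 3, isOpen_univ, Set.subset_univ _,
    (stdPrimitive 3).contDiff.contDiffOn, isPrimitiveOn_stdPrimitive m _, liouville⟩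
  · have bounded : Bornology.IsBounded (boundedDomain m R) :=
      Metric.isBounded_ball.subset fun z hz => mem_ball_zero_iff.2 hz.1
    exact Metric.isCompact_of_isClosed_isBounded isClosed_closure bounded.closure
  · obtain ⟨X, hX, -, outward⟩ := liouville z hz hzR
    exact ⟨X, hX, outward.ne'⟩

end ContactBoundary

section CrossProduct

open scoped Matrix

variable {K : Type*} [Field K]

theorem dotProduct_smul_eq_cross_expansion (c u v w : Fin 3 → K) :
    (c ⬝ᵥ u ⨯₃ v) • w = (c ⬝ᵥ w ⨯₃ v) • u + (c ⬝ᵥ u ⨯₃ w) • v + (w ⬝ᵥ u ⨯₃ v) • c := by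
  simp only [Matrix.vec3_dotProduct, cross_apply, Matrix.cons_val]
  ext i
  fin_cases i <;>
    simp only [Fin.zero_eta, Fin.mk_one, Fin.reduceFinMk, Pi.add_apply, Pi.smul_apply,
      smul_eq_mul] <;>
    ring

theorem cross_linearCombination (u : Fin 2 → Fin 3 → K) (A : Matrix (Fin 2) (Fin 2) K) :
    (∑ a, A a 0 • u a) ⨯₃ (∑ a, A a 1 • u a) = A.det • (u 0 ⨯₃ u 1) := by
  have anticomm : u 1 ⨯₃ u 0 = -(u 0 ⨯₃ u 1) := (cross_anticomm _ _).symm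
  simp only [Fin.sum_univ_two, map_add, map_smul, LinearMap.add_apply, LinearMap.smul_apply,
    cross_self, anticomm, Matrix.det_fin_two]
  module

theorem exists_det_one_of_cross_eq {u v : Fin 2 → Fin 3 → K} (hu : u 0 ⨯₃ u 1 ≠ 0)
    (huv : u 0 ⨯₃ u 1 = v 0 ⨯₃ v 1) :
    ∃ A : Matrix (Fin 2) (Fin 2) K, A.det = 1 ∧ ∀ b, v b = ∑ a, A a b • u a := by
  obtain ⟨k, hk⟩ := Function.ne_iff.1 hu
  set c : Fin 3 → K := Pi.single k ((u 0 ⨯₃ u 1) k)⁻¹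
  have hc : c ⬝ᵥ u 0 ⨯₃ u 1 = 1 := by simpa [c] using inv_mul_cancel₀ hk
  set A : Matrix (Fin 2) (Fin 2) K := .of ![fun b => c ⬝ᵥ v b ⨯₃ u 1, fun b => c ⬝ᵥ u 0 ⨯₃ v b]
  have coplanar (b : Fin 2) : v b ⬝ᵥ u 0 ⨯₃ u 1 = 0 := by
    rw [huv]
    fin_cases b
    exacts [dot_self_cross _ _, dot_cross_self _ _]
  have hA (b : Fin 2) : v b = ∑ a, A a b • u a := by
    have cramer := dotProduct_smul_eq_cross_expansion c (u 0) (u 1) (v b)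
    rw [hc, coplanar, one_smul, zero_smul, add_zero] at cramer
    simpa [A, Fin.sum_univ_two] using cramer
  refine ⟨A, ?_, hA⟩
  have det_smul : A.det • (u 0 ⨯₃ u 1) = (1 : K) • (u 0 ⨯₃ u 1) := by
    rw [← cross_linearCombination, ← hA, ← hA, one_smul, huv]
  exact smul_left_injective K hu det_smul

/-- For `d i ≠ 0`, a basis of the plane orthogonal to `d` whose cross product is `d`. -/
def crossFrame (d : Fin 3 → K) (i : Fin 3) : Fin 2 → Fin 3 → K :=
  ![(d i)⁻¹ • (Pi.single (i + 1) 1 ⨯₃ d), Pi.single (i + 2) 1 ⨯₃ d]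

theorem dotProduct_crossFrame (d : Fin 3 → K) (i : Fin 3) (a : Fin 2) :
    d ⬝ᵥ crossFrame d i a = 0 := by
  fin_cases a <;> simp [crossFrame, dotProduct_smul]

theorem cross_crossFrame {d : Fin 3 → K} {i : Fin 3} (hi : d i ≠ 0) :
    crossFrame d i 0 ⨯₃ crossFrame d i 1 = d := by
  have triple_product : Pi.single (i + 2) 1 ⬝ᵥ Pi.single (i + 1) 1 ⨯₃ d = -d i := by
    simp only [Matrix.vec3_dotProduct, cross_apply, Matrix.cons_val]
    fin_cases i <;> simp
  have cross_cross : Pi.single (i + 1) 1 ⨯₃ d ⨯₃ (Pi.single (i + 2) 1 ⨯₃ d) = d i • d := by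
    rw [cross_cross_eq_smul_sub_smul', dotProduct_comm _ d, dot_cross_self, triple_product,
      zero_smul, zero_sub, neg_smul, neg_neg]
  simp [crossFrame, cross_cross, hi]

theorem linearIndependent_crossFrame {d : Fin 3 → K} {i : Fin 3} (hi : d i ≠ 0) :
    LinearIndependent K (crossFrame d i) := by
  have cross_ne_zero : crossFrame d i 0 ⨯₃ crossFrame d i 1 ≠ 0 := by
    rw [cross_crossFrame hi]
    exact fun h => hi (congrFun h i)
  convert crossProduct_ne_zero_iff_linearIndependent.1 cross_ne_zero using 1
  ext a : 1
  fin_cases a <;> rfl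

end CrossProduct

section ChernClass

variable {m : ℕ} {M : Set (Cn 3)}

theorem firstChernClassVanishes_of_det_one {ι : Type} {U : ι → Set (Cn 3)}
    {e : ι → Fin 2 → Cn 3 → Cn 3} (hU : ∀ i, IsOpen (U i)) (hcover : M ⊆ ⋃ i, U i)
    (he : ∀ i a, ContinuousOn (e i a) (U i ∩ M))
    (hframe : ∀ i, ∀ z ∈ U i ∩ M,
      (∀ a, e i a z ∈ hyperTangent m z) ∧ LinearIndependent ℂ fun a => e i a z)
    (hdet : ∀ i j, ∀ z ∈ U i ∩ U j ∩ M, ∃ A : Matrix (Fin 2) (Fin 2) ℂ,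
      A.det = 1 ∧ ∀ b, e j b z = ∑ a, A a b • e i a z) :
    FirstChernClassVanishes m M := by
  choose! g g_det g_trans using hdet
  exact ⟨ι, U, e, g, 0, 0, hU, hcover, he, hframe, g_trans, fun _ _ => continuousOn_const,
    fun i j z hz => by simp [g_det i j z hz], fun _ _ => continuousOn_const, by simp⟩

theorem continuousOn_crossFrame_hyperPartial (m : ℕ) (i : Fin 3) (a : Fin 2) :
    ContinuousOn (fun z => crossFrame (hyperPartial m z) i a) {z | hyperPartial m z i ≠ 0} := by
  have hd := continuous_hyperPartial m
  have cross (v : Fin 3 → ℂ) : Continuous fun z => crossProduct v (hyperPartial m z) :=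
    (crossProduct v).continuous_of_finiteDimensional.comp hd
  fin_cases a
  · exact (((continuous_apply i).comp hd).continuousOn.inv₀ fun _ hz => hz).smul
      (cross _).continuousOn
  · exact (cross _).continuousOn

theorem firstChernClassVanishes (hM : M ⊆ hypersurface m) : FirstChernClassVanishes m M := by
  refine firstChernClassVanishes_of_det_one (U := fun i => {z | hyperPartial m z i ≠ 0})
    (e := fun i a z => WithLp.toLp 2 (crossFrame (hyperPartial m z) i a))
    (fun i => isOpen_ne_fun ((continuous_apply i).comp (continuous_hyperPartial m))
      continuous_const) (fun z hz => ?_)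
    (fun i a => (PiLp.continuous_toLp 2 _).comp_continuousOn
      ((continuousOn_crossFrame_hyperPartial m i a).mono Set.inter_subset_left))
    (fun i z hz => ⟨fun a => ?_, ?_⟩) ?_
  · exact Set.mem_iUnion.2 (Function.ne_iff.1 (hyperPartial_ne_zero (hM hz)))
  · exact mem_hyperTangent_iff.2 (dotProduct_crossFrame _ i a)
  · exact (linearIndependent_crossFrame hz.1).map'
      (WithLp.linearEquiv 2 ℂ (Fin 3 → ℂ)).symm.toLinearMap (LinearEquiv.ker _)
  · rintro i j z ⟨⟨hi, hj⟩, -⟩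
    obtain ⟨A, det_A, hA⟩ := exists_det_one_of_cross_eq (u := crossFrame (hyperPartial m z) i)
      (v := crossFrame (hyperPartial m z) j)
      (by rw [cross_crossFrame hi]; exact fun h => hi (congrFun h i))
      (by rw [cross_crossFrame hi, cross_crossFrame hj])
    exact ⟨A, det_A, fun b => by rw [hA b]; simp⟩

end ChernClass

section Logarithm

theorem exists_contDiff_log {g : ℝ → ℂ} (hg : ContDiff ℝ ∞ g) (hg0 : ∀ s, g s ≠ 0) :
    ∃ L : ℝ → ℂ, ContDiff ℝ ∞ L ∧ ∀ s, Complex.exp (L s) = g s := by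
  have contDiff_logDeriv : ContDiff ℝ ∞ fun s => deriv g s / g s := by
    simp only [div_eq_mul_inv]
    exact (contDiff_infty_iff_deriv.1 hg).2.mul (hg.inv hg0)
  set L : ℝ → ℂ := fun u => Complex.log (g 0) + ∫ s in (0 : ℝ)..u, deriv g s / g s with hL
  have hasDerivAt_L (s : ℝ) : HasDerivAt L (deriv g s / g s) s :=
    (contDiff_logDeriv.continuous.integral_hasStrictDerivAt 0 s).hasDerivAt.const_add _
  have deriv_L : deriv L = fun s => deriv g s / g s := funext fun s => (hasDerivAt_L s).deriv
  refine ⟨L, contDiff_infty_iff_deriv.2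
    ⟨fun s => (hasDerivAt_L s).differentiableAt, deriv_L ▸ contDiff_logDeriv⟩, fun s => ?_⟩
  have hasDerivAt_quotient (s : ℝ) : HasDerivAt (fun s => g s * Complex.exp (-L s)) 0 s := by
    refine ((contDiff_infty_iff_deriv.1 hg).1 s).hasDerivAt.mul (hasDerivAt_L s).neg.cexp
      |>.congr_deriv ?_
    field_simp [hg0 s]
    ring
  have quotient_eq_one : g s * Complex.exp (-L s) = 1 := by
    rw [is_const_of_deriv_eq_zero (fun s => (hasDerivAt_quotient s).differentiableAt)
      (fun s => (hasDerivAt_quotient s).deriv) s 0]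
    simp [hL, Complex.exp_neg, Complex.exp_log (hg0 0), hg0 0]
  rw [Complex.exp_neg, mul_inv_eq_one₀ (Complex.exp_ne_zero _)] at quotient_eq_one
  exact quotient_eq_one.symm

theorem eq_pi_of_sin_nonneg {θ : ℝ → ℝ} {a b : ℝ} (hθ : ContinuousOn θ (Set.uIcc a b))
    (hsin : ∀ s ∈ Set.uIcc a b, 0 ≤ Real.sin (θ s)) (ha : θ a = 0) (hb : Real.cos (θ b) = -1) :
    θ b = Real.pi := by
  have sin_nonneg {y : ℝ} (hy : y ∈ Set.uIcc 0 (θ b)) : 0 ≤ Real.sin y := by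
    rw [← ha] at hy
    obtain ⟨s, hs, rfl⟩ := intermediate_value_uIcc hθ hy
    exact hsin s hs
  obtain ⟨k, hk⟩ := Real.cos_eq_neg_one_iff.1 hb
  have pi_pos := Real.pi_pos
  rcases lt_trichotomy k 0 with hneg | rfl | hpos
  · have hk1 : (k : ℝ) ≤ -1 := by exact_mod_cast Int.le_sub_one_of_lt hneg
    have := sin_nonneg (y := -(Real.pi / 2)) (Set.mem_uIcc.2 (.inr (by constructor <;> nlinarith)))
    norm_num at this
  · simpa using hk.symm
  · have hk1 : (1 : ℝ) ≤ k := by exact_mod_cast hpos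
    have := sin_nonneg (y := Real.pi / 2 + Real.pi)
      (Set.mem_uIcc.2 (.inl (by constructor <;> nlinarith)))
    norm_num [Real.sin_add_pi] at this

/-- The values `(1 - s²)(1 + is)² - 1/2` of `z₃ ^ (m + 1)` along the sphere which lifts the
figure-eight map to `H`, in terms of the first coordinate `s` on the sphere. -/
noncomputable def figureEightLoop (s : ℝ) : ℂ :=
  (1 - (s : ℂ) ^ 2) * (1 + Complex.I * s) ^ 2 - 1 / 2

theorem figureEightLoop_eq (s : ℝ) :
    figureEightLoop s = ((1 - s ^ 2) ^ 2 - 1 / 2 : ℝ) + (2 * s * (1 - s ^ 2) : ℝ) * Complex.I := by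
  push_cast [figureEightLoop]
  linear_combination (1 - (s : ℂ) ^ 2) * s ^ 2 * Complex.I_sq

theorem figureEightLoop_re (s : ℝ) : (figureEightLoop s).re = (1 - s ^ 2) ^ 2 - 1 / 2 := by
  rw [figureEightLoop_eq, ← Complex.mk_eq_add_mul_I]

theorem figureEightLoop_im (s : ℝ) : (figureEightLoop s).im = 2 * s * (1 - s ^ 2) := by
  rw [figureEightLoop_eq, ← Complex.mk_eq_add_mul_I]

theorem figureEightLoop_ne_zero (s : ℝ) : figureEightLoop s ≠ 0 := by
  intro h
  have hre : (1 - s ^ 2) ^ 2 = 1 / 2 := by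
    rw [← sub_eq_zero, ← figureEightLoop_re, h, Complex.zero_re]
  have him : 2 * s * (1 - s ^ 2) = 0 := by rw [← figureEightLoop_im, h, Complex.zero_im]
  rcases mul_eq_zero.1 him with hs | hs
  · obtain rfl : s = 0 := by linarith
    norm_num at hre
  · norm_num [hs] at hre

theorem contDiff_figureEightLoop : ContDiff ℝ ∞ figureEightLoop := by
  have contDiff_coe : ContDiff ℝ ∞ fun s : ℝ => (s : ℂ) := Complex.ofRealCLM.contDiff
  unfold figureEightLoop
  fun_prop

theorem conj_figureEightLoop_neg (s : ℝ) :
    (starRingEnd ℂ) (figureEightLoop (-s)) = figureEightLoop s := by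
  simp [figureEightLoop, map_ofNat]

variable {L : ℝ → ℂ}

theorem log_figureEightLoop_one_sub_zero (hL : Continuous L)
    (hexp : ∀ s, Complex.exp (L s) = figureEightLoop s) : L 1 - L 0 = Real.pi * Complex.I := by
  have exp_sub (s : ℝ) : Complex.exp (L s - L 0) = 2 * figureEightLoop s := by
    rw [Complex.exp_sub, hexp, hexp, show figureEightLoop 0 = 1 / 2 by norm_num [figureEightLoop]]
    ring
  have exp_sub_one : Complex.exp (L 1 - L 0) = -1 := by
    norm_num [exp_sub, figureEightLoop]
  have sin_nonneg (s : ℝ) (hs : s ∈ Set.uIcc 0 1) : 0 ≤ Real.sin (L s - L 0).im := by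
    rw [Set.uIcc_of_le zero_le_one] at hs
    rw [← mul_nonneg_iff_of_pos_left (Real.exp_pos (L s - L 0).re), ← Complex.exp_im, exp_sub,
      two_mul, Complex.add_im, figureEightLoop_im]
    have : 0 ≤ 1 - s ^ 2 := by nlinarith [hs.1, hs.2]
    have := hs.1
    positivity
  have re_eq_zero : (L 1 - L 0).re = 0 := by
    simpa [Complex.norm_exp] using congrArg norm exp_sub_one
  have cos_eq_neg_one : Real.cos (L 1 - L 0).im = -1 := by
    simpa [Complex.exp_re, re_eq_zero, -Complex.sub_re, -Complex.sub_im]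
      using congrArg Complex.re exp_sub_one
  have im_eq_pi := eq_pi_of_sin_nonneg (θ := fun s => (L s - L 0).im)
    (Complex.continuous_im.comp (hL.sub continuous_const)).continuousOn sin_nonneg (by simp)
    cos_eq_neg_one
  rw [← Complex.re_add_im (L 1 - L 0), re_eq_zero, im_eq_pi, Complex.ofReal_zero, zero_add]

theorem log_figureEightLoop_one_sub_neg_one (hL : Continuous L)
    (hexp : ∀ s, Complex.exp (L s) = figureEightLoop s) :
    L 1 - L (-1) = 2 * Real.pi * Complex.I := by
  have upper := log_figureEightLoop_one_sub_zero hL hexp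
  have lower := log_figureEightLoop_one_sub_zero (L := fun s => (starRingEnd ℂ) (L (-s)))
    (Complex.continuous_conj.comp (hL.comp continuous_neg))
    fun s => by rw [Complex.exp_conj, hexp, conj_figureEightLoop_neg]
  have lower_conj := congrArg (starRingEnd ℂ) lower
  simp only [map_sub, map_mul, Complex.conj_conj, Complex.conj_I, Complex.conj_ofReal,
    neg_zero] at lower_conj
  linear_combination upper - lower_conj

end Logarithm

section Sphere

variable {E : Type*} [NormedAddCommGroup E] [InnerProductSpace ℝ E] {d : ℕ}
  [Fact (finrank ℝ E = d + 1)]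

theorem mfderiv_comp_coe_sphere {F : Type*} [NormedAddCommGroup F] [NormedSpace ℝ F] {φ : E → F}
    {t : Metric.sphere (0 : E) 1} (hφ : DifferentiableAt ℝ φ t) (u : TangentSpace (𝓡 d) t) :
    mfderiv (𝓡 d) 𝓘(ℝ, F) (fun s : Metric.sphere (0 : E) 1 => φ s) t u =
      fderiv ℝ φ t (mvfderiv (𝓡 d) (Subtype.val : Metric.sphere (0 : E) 1 → E) t u) := by
  have chain_rule := mfderiv_comp t hφ.mdifferentiableAt
    ((contMDiff_coe_sphere (n := d) (m := 1)).mdifferentiable one_ne_zero t)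
  rw [mfderiv_eq_fderiv] at chain_rule
  exact congrArg (fun A => A u) chain_rule

theorem exists_mvfderiv_coe_sphere_eq_iff {t : Metric.sphere (0 : E) 1} {v : E} :
    (∃ u, mvfderiv (𝓡 d) (Subtype.val : Metric.sphere (0 : E) 1 → E) t u = v) ↔
      inner ℝ (t : E) v = 0 := by
  rw [← Submodule.mem_orthogonal_singleton_iff_inner_right, ← range_mvfderiv_subtypeVal (n := d)]
  rfl

variable {n : ℕ} {φ : EuclideanSpace ℝ (Fin 3) → Cn n}

theorem isIsotropicImmersion_comp_coe_sphere (hφ : ContDiff ℝ ∞ φ)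
    (himm : ∀ t : S2, ∀ v, inner ℝ t.1 v = 0 → fderiv ℝ φ t v = 0 → v = 0)
    (hiso : ∀ t : S2, ∀ u v, inner ℝ t.1 u = 0 → inner ℝ t.1 v = 0 →
      stdForm (fderiv ℝ φ t u) (fderiv ℝ φ t v) = 0) :
    IsIsotropicImmersion fun t : S2 => φ t := by
  have mfderiv_eq (t : S2) := mfderiv_comp_coe_sphere (d := 2) (t := t)
    (hφ.differentiable (by simp)).differentiableAt
  have tangent (t : S2) (u : TangentSpace (𝓡 2) t) :
      inner ℝ t.1 (mvfderiv (𝓡 2) (Subtype.val : S2 → EuclideanSpace ℝ (Fin 3)) t u) = 0 :=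
    exists_mvfderiv_coe_sphere_eq_iff.1 ⟨u, rfl⟩
  refine ⟨hφ.contMDiff.comp contMDiff_coe_sphere, fun t => ?_, fun t u v => ?_⟩
  · refine (injective_iff_map_eq_zero _).2 fun u hu => injective_mvfderiv_subtypeVal_sphere t ?_
    rw [map_zero]
    exact himm t _ (tangent t u) ((mfderiv_eq t u).symm.trans hu)
  · rw [mfderiv_eq, mfderiv_eq]
    exact hiso t _ _ (tangent t u) (tangent t v)

theorem mem_sphereTangent_comp_coe_sphere {φ : EuclideanSpace ℝ (Fin 3) → Cn 3} {t : S2}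
    (hφ : DifferentiableAt ℝ φ t) {w : Cn 3} :
    w ∈ sphereTangent (fun s : S2 => φ s) t ↔ ∃ v, inner ℝ t.1 v = 0 ∧ fderiv ℝ φ t v = w := by
  simp only [← exists_mvfderiv_coe_sphere_eq_iff (d := 2)]
  constructor
  · rintro ⟨u, rfl⟩
    exact ⟨_, ⟨u, rfl⟩, (mfderiv_comp_coe_sphere hφ u).symm⟩
  · rintro ⟨_, ⟨u, rfl⟩, rfl⟩
    exact ⟨u, mfderiv_comp_coe_sphere hφ u⟩

end Sphere

section FigureEight

variable {n : ℕ}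

/-- The figure-eight map `S^n → ℂⁿ` in any dimension, extended to the ambient space `ℝ^(n+1)` of
the sphere. -/
noncomputable def figureEightMap (x : EuclideanSpace ℝ (Fin (n + 1))) : Cn n :=
  WithLp.toLp 2 fun i => (x i.succ : ℂ) * (1 + Complex.I * x 0)

/-- The figure-eight map, with a function `h` of the first coordinate on the sphere appended as a
last coordinate: a lift of the figure-eight map along the projection `ℂ^(n+1) → ℂⁿ`. -/
noncomputable def figureEightLift (h : ℝ → ℂ) (x : EuclideanSpace ℝ (Fin (n + 1))) : Cn (n + 1) :=
  WithLp.toLp 2 (Fin.snoc (α := fun _ => ℂ) (figureEightMap x) (h (x 0)))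

theorem figureEightMap_apply (x : EuclideanSpace ℝ (Fin (n + 1))) (i : Fin n) :
    figureEightMap x i = x i.succ * (1 + Complex.I * x 0) :=
  rfl

theorem figureEightLift_castSucc (h : ℝ → ℂ) (x : EuclideanSpace ℝ (Fin (n + 1))) (i : Fin n) :
    figureEightLift h x i.castSucc = figureEightMap x i :=
  Fin.snoc_castSucc (α := fun _ => ℂ) ..

theorem figureEightLift_last (h : ℝ → ℂ) (x : EuclideanSpace ℝ (Fin (n + 1))) :
    figureEightLift h x (Fin.last n) = h (x 0) :=
  Fin.snoc_last (α := fun _ => ℂ) ..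

theorem contDiff_figureEightMap :
    ContDiff ℝ ∞ (figureEightMap : EuclideanSpace ℝ (Fin (n + 1)) → Cn n) := by
  have contDiff_coord (j : Fin (n + 1)) :
      ContDiff ℝ ∞ fun x : EuclideanSpace ℝ (Fin (n + 1)) => (x j : ℂ) :=
    Complex.ofRealCLM.contDiff.comp (EuclideanSpace.proj (𝕜 := ℝ) j).contDiff
  exact contDiff_piLp' 2 fun i =>
    (contDiff_coord i.succ).mul (contDiff_const.add (contDiff_const.mul (contDiff_coord 0)))

variable {h : ℝ → ℂ}

theorem contDiff_figureEightLift (hh : ContDiff ℝ ∞ h) :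
    ContDiff ℝ ∞ (figureEightLift h : EuclideanSpace ℝ (Fin (n + 1)) → Cn (n + 1)) := by
  refine (contDiff_piLp 2).2 fun i => ?_
  induction i using Fin.lastCases with
  | last =>
    simp only [figureEightLift_last]
    exact hh.comp (EuclideanSpace.proj (𝕜 := ℝ) (0 : Fin (n + 1))).contDiff
  | cast i =>
    simp only [figureEightLift_castSucc]
    exact (contDiff_piLp 2).1 contDiff_figureEightMap i

theorem fderiv_euclideanSpace_apply {ι E : Type*} [Finite ι] [NormedAddCommGroup E]
    [NormedSpace ℝ E] {φ : E → EuclideanSpace ℂ ι} {x : E} (hφ : DifferentiableAt ℝ φ x) (v : E)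
    (i : ι) : fderiv ℝ φ x v i = fderiv ℝ (fun y => φ y i) x v := by
  have := Fintype.ofFinite ι
  exact congrArg (fun A => A v)
    ((PiLp.proj (𝕜 := ℝ) 2 (fun _ : ι => ℂ) i).hasFDerivAt.comp x hφ.hasFDerivAt).fderiv.symm

variable (x u v : EuclideanSpace ℝ (Fin (n + 1)))

theorem fderiv_figureEightMap_apply (i : Fin n) :
    fderiv ℝ figureEightMap x v i =
      v i.succ * (1 + Complex.I * x 0) + x i.succ * (Complex.I * v 0) := by
  have coord (j : Fin (n + 1)) : HasFDerivAt (fun y : EuclideanSpace ℝ (Fin (n + 1)) => (y j : ℂ))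
      (Complex.ofRealCLM ∘L EuclideanSpace.proj (𝕜 := ℝ) j) x :=
    Complex.ofRealCLM.hasFDerivAt.comp x (EuclideanSpace.proj (𝕜 := ℝ) j).hasFDerivAt
  have product_rule := (coord i.succ).mul (((coord 0).const_mul Complex.I).const_add 1)
  rw [fderiv_euclideanSpace_apply (contDiff_figureEightMap.differentiable (by simp) x)]
  refine (congrArg (fun A => A v) product_rule.fderiv).trans ?_
  simp only [add_apply, smul_apply, ContinuousLinearMap.comp_apply, PiLp.proj_apply,
    Complex.ofRealCLM_apply, smul_eq_mul]
  ring

theorem fderiv_figureEightLift_castSucc (hh : ContDiff ℝ ∞ h) (i : Fin n) :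
    fderiv ℝ (figureEightLift h) x v i.castSucc = fderiv ℝ figureEightMap x v i := by
  rw [fderiv_euclideanSpace_apply (contDiff_figureEightMap.differentiable (by simp) x),
    fderiv_euclideanSpace_apply ((contDiff_figureEightLift hh).differentiable (by simp) x)]
  simp only [figureEightLift_castSucc]

theorem fderiv_figureEightLift_last (hh : ContDiff ℝ ∞ h) :
    fderiv ℝ (figureEightLift h) x v (Fin.last n) = v 0 * deriv h (x 0) := by
  have chain_rule := ((hh.differentiable (by simp)) (x 0)).hasDerivAt.hasFDerivAt.comp x
    (EuclideanSpace.proj (𝕜 := ℝ) (0 : Fin (n + 1))).hasFDerivAt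
  rw [fderiv_euclideanSpace_apply ((contDiff_figureEightLift hh).differentiable (by simp) x)]
  simp only [figureEightLift_last]
  refine (congrArg (fun A => A v) chain_rule.fderiv).trans ?_
  simp

theorem stdForm_fderiv_figureEightMap :
    stdForm (fderiv ℝ figureEightMap x u) (fderiv ℝ figureEightMap x v) =
      v 0 * inner ℝ x u - u 0 * inner ℝ x v := by
  have summand (i : Fin n) :
      (fderiv ℝ figureEightMap x u i).re * (fderiv ℝ figureEightMap x v i).im -
          (fderiv ℝ figureEightMap x u i).im * (fderiv ℝ figureEightMap x v i).re =
        v 0 * (x i.succ * u i.succ) - u 0 * (x i.succ * v i.succ) := by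
    simp only [fderiv_figureEightMap_apply, Complex.add_re, Complex.add_im, Complex.re_ofReal_mul,
      Complex.im_ofReal_mul, Complex.re_mul_ofReal, Complex.im_mul_ofReal, Complex.one_re,
      Complex.one_im, Complex.I_re, Complex.I_im]
    ring
  simp only [stdForm, summand, Finset.sum_sub_distrib, ← Finset.mul_sum, PiLp.inner_apply,
    RCLike.inner_apply, conj_trivial, Fin.sum_univ_succ, mul_comm (x _)]
  ring

theorem stdForm_fderiv_figureEightLift (hh : ContDiff ℝ ∞ h) :
    stdForm (fderiv ℝ (figureEightLift h) x u) (fderiv ℝ (figureEightLift h) x v) =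
      v 0 * inner ℝ x u - u 0 * inner ℝ x v := by
  rw [← stdForm_fderiv_figureEightMap, stdForm, stdForm, Fin.sum_univ_castSucc]
  simp only [fderiv_figureEightLift_castSucc x _ hh, fderiv_figureEightLift_last x _ hh,
    Complex.re_ofReal_mul, Complex.im_ofReal_mul]
  ring

variable {x u v}

theorem eq_zero_of_fderiv_figureEightMap_eq_zero (hx : x ≠ 0) (hxv : inner ℝ x v = 0)
    (hv : fderiv ℝ figureEightMap x v = 0) : v = 0 := by
  have coord (i : Fin n) := congrArg (fun w : Cn n => w i) hv
  simp only [fderiv_figureEightMap_apply, PiLp.zero_apply] at coord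
  have succ_eq_zero (i : Fin n) : v i.succ = 0 := by simpa using congrArg Complex.re (coord i)
  have smul_eq_zero : v 0 • x = 0 := by
    ext j
    induction j using Fin.cases with
    | zero => simpa [PiLp.inner_apply, Fin.sum_univ_succ, succ_eq_zero] using hxv
    | succ i => simpa [succ_eq_zero, mul_comm] using congrArg Complex.im (coord i)
  ext j
  induction j using Fin.cases with
  | zero => exact (_root_.smul_eq_zero.1 smul_eq_zero).resolve_right hx
  | succ i => exact succ_eq_zero i

theorem eq_zero_of_fderiv_figureEightLift_eq_zero (hh : ContDiff ℝ ∞ h) (hx : x ≠ 0)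
    (hxv : inner ℝ x v = 0) (hv : fderiv ℝ (figureEightLift h) x v = 0) : v = 0 := by
  refine eq_zero_of_fderiv_figureEightMap_eq_zero hx hxv (PiLp.ext fun i => ?_)
  rw [← fderiv_figureEightLift_castSucc x v hh, hv]
  rfl

theorem isIsotropicImmersion_figureEight : IsIsotropicImmersion figureEight := by
  have figureEight_eq : figureEight = fun t : S2 => figureEightMap t.1 := by
    ext t i
    fin_cases i <;> rfl
  rw [figureEight_eq]
  exact isIsotropicImmersion_comp_coe_sphere contDiff_figureEightMap
    (fun t v => eq_zero_of_fderiv_figureEightMap_eq_zero (ne_zero_of_mem_unit_sphere t))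
    fun t u v hu hv => by simp [stdForm_fderiv_figureEightMap, hu, hv]

theorem isIsotropicImmersion_figureEightLift (hh : ContDiff ℝ ∞ h) :
    IsIsotropicImmersion fun t : S2 => figureEightLift h t.1 :=
  isIsotropicImmersion_comp_coe_sphere (contDiff_figureEightLift hh)
    (fun t v => eq_zero_of_fderiv_figureEightLift_eq_zero hh (ne_zero_of_mem_unit_sphere t))
    fun t u v hu hv => by simp [stdForm_fderiv_figureEightLift _ _ _ hh, hu, hv]

theorem eq_or_eq_single_of_figureEightMap_eq {y : EuclideanSpace ℝ (Fin (n + 1))}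
    (hnorm : ‖x‖ = ‖y‖) (hxy : figureEightMap x = figureEightMap y) :
    x = y ∨ ∃ ε, x = EuclideanSpace.single 0 ε ∧ y = EuclideanSpace.single 0 (-ε) := by
  have coord (i : Fin n) := congrArg (fun w : Cn n => w i) hxy
  simp only [figureEightMap_apply] at coord
  have succ_eq (i : Fin n) : x i.succ = y i.succ := by simpa using congrArg Complex.re (coord i)
  have sq_eq : x 0 ^ 2 = y 0 ^ 2 := by
    have := congrArg (· ^ 2) hnorm
    simpa [EuclideanSpace.norm_sq_eq, Fin.sum_univ_succ, succ_eq] using this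
  rw [or_iff_not_imp_left]
  intro hne
  have zero_ne : x 0 ≠ y 0 := fun h0 => hne <| PiLp.ext <| Fin.cases h0 succ_eq
  have succ_eq_zero (i : Fin n) : y i.succ = 0 := by
    have him := congrArg Complex.im (coord i)
    simp only [succ_eq] at him
    simpa [zero_ne] using him
  have zero_eq_neg : y 0 = -x 0 := by
    rw [(eq_or_eq_neg_of_sq_eq_sq _ _ sq_eq).resolve_left zero_ne, neg_neg]
  exact ⟨x 0, PiLp.ext <| Fin.cases (by simp) fun i => by simp [succ_eq, succ_eq_zero],
    PiLp.ext <| Fin.cases (by simp [zero_eq_neg]) fun i => by simp [succ_eq_zero]⟩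

theorem sum_sq_figureEightMap (hx : ‖x‖ = 1) :
    ∑ i, figureEightMap x i ^ 2 = figureEightLoop (x 0) + 1 / 2 := by
  have sum_succ : ∑ i : Fin n, x i.succ ^ 2 = 1 - x 0 ^ 2 := by
    have := EuclideanSpace.norm_sq_eq x
    simp only [hx, Fin.sum_univ_succ, Real.norm_eq_abs, sq_abs] at this
    linarith
  simp only [figureEightMap_apply, mul_pow, ← Finset.sum_mul, ← Complex.ofReal_pow,
    ← Complex.ofReal_sum, sum_succ, figureEightLoop]
  push_cast
  ring

theorem figureEightLift_single (h : ℝ → ℂ) (ε : ℝ) :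
    figureEightLift h (EuclideanSpace.single (0 : Fin (n + 1)) ε) =
      EuclideanSpace.single (Fin.last n) (h ε) := by
  ext i
  induction i using Fin.lastCases with
  | last => simp [figureEightLift_last]
  | cast i => simp [figureEightLift_castSucc, figureEightMap_apply]

end FigureEight

section Poles

/-- The north pole `(1, 0, 0)`; the figure-eight map identifies it with the south pole `-northPole`
and is injective otherwise. -/
noncomputable def northPole : S2 := ⟨EuclideanSpace.single 0 1, by simp⟩

theorem coe_neg_northPole : (-northPole).1 = EuclideanSpace.single 0 (-1) := by
  ext j
  fin_cases j <;> simp [northPole]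

variable {m : ℕ} {h : ℝ → ℂ}

theorem figureEightLift_northPole (h : ℝ → ℂ) :
    figureEightLift h northPole.1 = EuclideanSpace.single 2 (h 1) :=
  figureEightLift_single h 1

theorem figureEightLift_neg_northPole (h : ℝ → ℂ) :
    figureEightLift h (-northPole).1 = EuclideanSpace.single 2 (h (-1)) := by
  rw [coe_neg_northPole]
  exact figureEightLift_single h (-1)

theorem eq_or_eq_northPole_of_figureEightMap_eq {s t : S2}
    (hst : figureEightMap s.1 = figureEightMap t.1) :
    s = t ∨ s = northPole ∧ t = -northPole ∨ s = -northPole ∧ t = northPole := by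
  refine (eq_or_eq_single_of_figureEightMap_eq (by simp) hst).imp Subtype.ext ?_
  rintro ⟨ε, hs, ht⟩
  have abs_eq_one : |ε| = 1 := by simpa [hs] using norm_eq_of_mem_sphere s
  rcases (abs_eq zero_le_one).1 abs_eq_one with rfl | rfl
  · exact .inl ⟨Subtype.ext hs, Subtype.ext (ht.trans coe_neg_northPole.symm)⟩
  · rw [neg_neg] at ht
    exact .inr ⟨Subtype.ext (hs.trans coe_neg_northPole.symm), Subtype.ext ht⟩

theorem mem_sphereTangent_figureEightLift_single (hh : ContDiff ℝ ∞ h) {t : S2} {ε : ℝ}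
    (hε : ε ≠ 0) (ht : t.1 = EuclideanSpace.single 0 ε) {w : Cn 3} :
    w ∈ sphereTangent (fun s : S2 => figureEightLift h s.1) t ↔
      w 2 = 0 ∧ ∀ i : Fin 2, (w i.castSucc).im = ε * (w i.castSucc).re := by
  rw [mem_sphereTangent_comp_coe_sphere ((contDiff_figureEightLift hh).differentiable (by simp) _)]
  have inner_eq_zero_iff (v : EuclideanSpace ℝ (Fin 3)) : inner ℝ t.1 v = 0 ↔ v 0 = 0 := by
    simp [ht, EuclideanSpace.inner_single_left, hε]
  have fderiv_last (v : EuclideanSpace ℝ (Fin 3)) :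
      fderiv ℝ (figureEightLift h) t.1 v 2 = v 0 * deriv h (t.1 0) :=
    fderiv_figureEightLift_last t.1 v hh
  have fderiv_castSucc (v : EuclideanSpace ℝ (Fin 3)) (hv : v 0 = 0) (i : Fin 2) :
      fderiv ℝ (figureEightLift h) t.1 v i.castSucc = v i.succ * (1 + Complex.I * ε) := by
    rw [fderiv_figureEightLift_castSucc t.1 v hh, fderiv_figureEightMap_apply]
    simp [hv, ht]
  simp only [inner_eq_zero_iff]
  constructor
  · rintro ⟨v, hv, rfl⟩
    exact ⟨by simp [fderiv_last, hv], fun i => by simp [fderiv_castSucc v hv, mul_comm]⟩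
  · rintro ⟨hw2, hw⟩
    set v : EuclideanSpace ℝ (Fin 3) := WithLp.toLp 2 (Fin.cons 0 fun i => (w i.castSucc).re)
    have hv : v 0 = 0 := rfl
    refine ⟨v, hv, PiLp.ext fun j => ?_⟩
    induction j using Fin.lastCases with
    | last => simpa [fderiv_last, hv] using hw2.symm
    | cast i =>
      rw [fderiv_castSucc v hv]
      apply Complex.ext <;> simp [v, hw, mul_comm]

theorem mem_sphereTangent_northPole_sup {h' : ℝ → ℂ} (hh : ContDiff ℝ ∞ h)
    (hh' : ContDiff ℝ ∞ h') {w : Cn 3} :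
    w ∈ sphereTangent (fun s : S2 => figureEightLift h s.1) northPole ⊔
        sphereTangent (fun s : S2 => figureEightLift h' s.1) (-northPole) ↔ w 2 = 0 := by
  simp only [Submodule.mem_sup,
    mem_sphereTangent_figureEightLift_single hh one_ne_zero (t := northPole) rfl,
    mem_sphereTangent_figureEightLift_single hh' (neg_ne_zero.2 one_ne_zero)
      coe_neg_northPole]
  constructor
  · rintro ⟨u, ⟨hu, -⟩, v, ⟨hv, -⟩, rfl⟩
    simp [hu, hv]
  · intro hw
    set a : Fin 2 → ℝ := fun i => ((w i.castSucc).re + (w i.castSucc).im) / 2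
    set b : Fin 2 → ℝ := fun i => ((w i.castSucc).re - (w i.castSucc).im) / 2
    refine ⟨!₂[⟨a 0, a 0⟩, ⟨a 1, a 1⟩, 0], ⟨rfl, fun i => ?_⟩,
      !₂[⟨b 0, -b 0⟩, ⟨b 1, -b 1⟩, 0], ⟨rfl, fun i => ?_⟩, ?_⟩
    · fin_cases i <;> simp
    · fin_cases i <;> simp
    · ext j
      fin_cases j
      · apply Complex.ext <;> simp [a, b] <;> ring
      · apply Complex.ext <;> simp [a, b] <;> ring
      · simp [hw]

theorem mem_hyperTangent_single {c : ℂ} (hc : c ≠ 0) {w : Cn 3} :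
    w ∈ hyperTangent m (EuclideanSpace.single 2 c) ↔ w 2 = 0 := by
  simp [mem_hyperTangent_iff, Fin.sum_univ_three, hyperPartial, hc, Nat.cast_add_one_ne_zero]

end Poles

section Configuration

/-- The root of unity by which the generator of the covering group of `H → ℂ²` acts. -/
noncomputable def deckRoot (m : ℕ) : ℂ := Complex.exp (2 * Real.pi * Complex.I / (m + 1))

theorem isPrimitiveRoot_deckRoot (m : ℕ) : IsPrimitiveRoot (deckRoot m) (m + 1) := by
  simpa [deckRoot] using Complex.isPrimitiveRoot_exp (m + 1) m.succ_ne_zero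

/-- `h` is a smooth `(m+1)`-st root of `figureEightLoop` on the line. As that loop winds once
around the origin on `[-1, 1]`, the values of `h` at the ends differ by the factor `deckRoot m`. -/
structure IsFigureEightRoot (m : ℕ) (h : ℝ → ℂ) : Prop where
  contDiff : ContDiff ℝ ∞ h
  pow_eq : ∀ s, h s ^ (m + 1) = figureEightLoop s
  monodromy : h 1 = deckRoot m * h (-1)

theorem exists_isFigureEightRoot (m : ℕ) : ∃ h, IsFigureEightRoot m h := by
  obtain ⟨L, hL, hexp⟩ := exists_contDiff_log contDiff_figureEightLoop figureEightLoop_ne_zero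
  refine ⟨fun s => Complex.exp (L s / (m + 1)), (hL.div_const _).cexp, fun s => ?_, ?_⟩
  · rw [← Complex.exp_nat_mul, ← hexp, Nat.cast_add_one,
      mul_div_cancel₀ _ (Nat.cast_add_one_ne_zero m)]
  · rw [deckRoot, ← Complex.exp_add, ← log_figureEightLoop_one_sub_neg_one hL.continuous hexp,
      ← add_div, sub_add_cancel]

/-- The `k`-th sphere of the configuration: the image under the `k`-th power of the deck
transformation of the lift of the figure-eight map with last coordinate `h`. -/
noncomputable def deckSphere (m : ℕ) (h : ℝ → ℂ) (k : ℕ) (t : S2) : Cn 3 :=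
  figureEightLift (fun s => deckRoot m ^ k * h s) t.1

variable {m : ℕ} {h : ℝ → ℂ}

theorem deckMap_iterate_figureEightLift (m : ℕ) (h : ℝ → ℂ) (k : ℕ) (t : S2) :
    (deckMap m)^[k] (figureEightLift h t.1) = deckSphere m h k t := by
  induction k with
  | zero => simp [deckSphere]
  | succ k ih =>
    rw [Function.iterate_succ_apply', ih]
    ext j
    fin_cases j
    · rfl
    · rfl
    · change deckRoot m * (deckRoot m ^ k * h (t.1 0)) = deckRoot m ^ (k + 1) * h (t.1 0)
      ring

namespace IsFigureEightRoot

variable (hh : IsFigureEightRoot m h) {i j : ℕ} {s t : S2}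
include hh

theorem ne_zero (x : ℝ) : h x ≠ 0 := fun h0 =>
  figureEightLoop_ne_zero x (by rw [← hh.pow_eq, h0, zero_pow m.succ_ne_zero])

theorem contDiff_const_mul (c : ℂ) : ContDiff ℝ ∞ fun x => c * h x :=
  contDiff_const.mul hh.contDiff

theorem deckSphere_mem_hypersurface (k : ℕ) (t : S2) : deckSphere m h k t ∈ hypersurface m := by
  have pow_eq : (deckRoot m ^ k * h (t.1 0)) ^ (m + 1) = figureEightLoop (t.1 0) := by
    rw [mul_pow, pow_right_comm, (isPrimitiveRoot_deckRoot m).pow_eq_one, one_pow, one_mul,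
      hh.pow_eq]
  have sum_sq := sum_sq_figureEightMap (n := 2) (norm_eq_of_mem_sphere t)
  rw [Fin.sum_univ_two, ← pow_eq] at sum_sq
  exact sum_sq

theorem deckSphere_northPole (k : ℕ) :
    deckSphere m h k northPole = deckSphere m h (k + 1) (-northPole) := by
  rw [deckSphere, deckSphere, figureEightLift_northPole, figureEightLift_neg_northPole,
    hh.monodromy, pow_succ, mul_assoc]

theorem eq_of_deckSphere_northPole_eq (hi : i < m) (hj : j < m)
    (hij : deckSphere m h i northPole = deckSphere m h j (-northPole)) : i + 1 = j := by
  rw [hh.deckSphere_northPole, deckSphere, deckSphere, figureEightLift_neg_northPole,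
    figureEightLift_neg_northPole] at hij
  have pow_eq : deckRoot m ^ (i + 1) = deckRoot m ^ j :=
    mul_right_cancel₀ (hh.ne_zero (-1)) (by simpa using congrArg (fun w : Cn 3 => w 2) hij)
  exact (isPrimitiveRoot_deckRoot m).pow_inj (by lia) (by lia) pow_eq

theorem eq_or_of_deckSphere_eq (hi : i < m) (hj : j < m)
    (hst : deckSphere m h i s = deckSphere m h j t) :
    (s = t ∧ i = j) ∨ (s = northPole ∧ t = -northPole ∧ i + 1 = j) ∨
      (s = -northPole ∧ t = northPole ∧ j + 1 = i) := by
  have map_eq : figureEightMap s.1 = figureEightMap t.1 := PiLp.ext fun a => by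
    simpa only [deckSphere, figureEightLift_castSucc]
      using congrArg (fun w : Cn 3 => w a.castSucc) hst
  rcases eq_or_eq_northPole_of_figureEightMap_eq map_eq with rfl | ⟨rfl, rfl⟩ | ⟨rfl, rfl⟩
  · have last_eq : deckRoot m ^ i * h (s.1 0) = deckRoot m ^ j * h (s.1 0) :=
      congrArg (fun w : Cn 3 => w 2) hst
    exact .inl ⟨rfl, (isPrimitiveRoot_deckRoot m).pow_inj (by lia) (by lia)
      (mul_right_cancel₀ (hh.ne_zero _) last_eq)⟩
  · exact .inr (.inl ⟨rfl, rfl, hh.eq_of_deckSphere_northPole_eq hi hj hst⟩)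
  · exact .inr (.inr ⟨rfl, rfl, hh.eq_of_deckSphere_northPole_eq hj hi hst.symm⟩)

theorem isLagrangianSphere_deckSphere (hi : i < m) :
    IsLagrangianSphere (hypersurface m) (deckSphere m h i) where
  toIsIsotropicImmersion := isIsotropicImmersion_figureEightLift (hh.contDiff_const_mul _)
  injective s t hst := by
    rcases hh.eq_or_of_deckSphere_eq hi hi hst with ⟨h_eq, -⟩ | ⟨-, -, h_eq⟩ | ⟨-, -, h_eq⟩
    exacts [h_eq, by lia, by lia]
  mem := hh.deckSphere_mem_hypersurface i

theorem sphereTangent_northPole_sup (i j : ℕ) :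
    sphereTangent (deckSphere m h i) northPole ⊔ sphereTangent (deckSphere m h j) (-northPole) =
      (hyperTangent m (deckSphere m h i northPole)).restrictScalars ℝ := by
  have ne_zero : deckRoot m ^ i * h 1 ≠ 0 :=
    mul_ne_zero (pow_ne_zero _ (Complex.exp_ne_zero _)) (hh.ne_zero 1)
  ext w
  rw [Submodule.restrictScalars_mem, deckSphere, figureEightLift_northPole,
    mem_hyperTangent_single ne_zero]
  exact mem_sphereTangent_northPole_sup (hh.contDiff_const_mul _) (hh.contDiff_const_mul _)

theorem sphereTangent_sup (hi : i < m) (hj : j < m) (hij : i ≠ j)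
    (hst : deckSphere m h i s = deckSphere m h j t) :
    sphereTangent (deckSphere m h i) s ⊔ sphereTangent (deckSphere m h j) t =
      (hyperTangent m (deckSphere m h i s)).restrictScalars ℝ := by
  rcases hh.eq_or_of_deckSphere_eq hi hj hst with ⟨-, h_eq⟩ | ⟨rfl, rfl, -⟩ | ⟨rfl, rfl, -⟩
  · exact absurd h_eq hij
  · exact hh.sphereTangent_northPole_sup i j
  · rw [sup_comm, hst]
    exact hh.sphereTangent_northPole_sup j i

theorem range_deckSphere_inter_succ (hi : i + 1 < m) :
    Set.range (deckSphere m h i) ∩ Set.range (deckSphere m h (i + 1)) =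
      {deckSphere m h i northPole} := by
  refine Set.eq_singleton_iff_unique_mem.2
    ⟨⟨⟨_, rfl⟩, ⟨_, (hh.deckSphere_northPole i).symm⟩⟩, ?_⟩
  rintro _ ⟨⟨s, rfl⟩, ⟨t, hst⟩⟩
  rcases hh.eq_or_of_deckSphere_eq (by lia) hi hst.symm with ⟨-, h_eq⟩ | ⟨rfl, -⟩ | ⟨-, -, h_eq⟩
  exacts [by lia, rfl, by lia]

theorem disjoint_range_deckSphere (hi : i < m) (hj : j < m) (hij : i + 2 ≤ j ∨ j + 2 ≤ i) :
    Disjoint (Set.range (deckSphere m h i)) (Set.range (deckSphere m h j)) := by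
  refine Set.disjoint_range_iff.2 fun s t hst => ?_
  rcases hh.eq_or_of_deckSphere_eq hi hj hst with ⟨-, h_eq⟩ | ⟨-, -, h_eq⟩ | ⟨-, -, h_eq⟩ <;> lia

theorem isAConfiguration_deckSphere :
    IsAConfiguration m (hypersurface m) fun k : Fin m => deckSphere m h k where
  lagrangian i := hh.isLagrangianSphere_deckSphere i.2
  transverse i j hij s t := hh.sphereTangent_sup i.2 j.2 (Fin.val_ne_of_ne hij)
  adjacent i j hij := by
    wlog h_succ : (i : ℕ) + 1 = j generalizing i j
    · rw [Set.inter_comm]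
      exact this j i hij.symm (hij.resolve_left h_succ)
    · rw [← h_succ, hh.range_deckSphere_inter_succ (by lia), Set.ncard_singleton]
  distant i j hij := (hh.disjoint_range_deckSphere i.2 j.2 hij).inter_eq

end IsFigureEightRoot

theorem exists_configuration (m : ℕ) :
    ∃ F : S2 → Cn 3, (∀ t, F t ∈ hypersurface m ∧ branchedCover (F t) = figureEight t) ∧
      IsAConfiguration m (hypersurface m) fun (k : Fin m) (t : S2) => (deckMap m)^[k] (F t) := by
  obtain ⟨h, hh⟩ := exists_isFigureEightRoot m
  refine ⟨fun t => figureEightLift h t.1, fun t => ⟨?_, ?_⟩, ?_⟩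
  · simpa [deckSphere] using hh.deckSphere_mem_hypersurface 0 t
  · ext i
    fin_cases i <;> rfl
  · simp only [deckMap_iterate_figureEightLift]
    exact hh.isAConfiguration_deckSphere

theorem IsAConfiguration.comp_castLE {M : Set (Cn 3)} {k l : ℕ} {f : Fin k → S2 → Cn 3}
    (hf : IsAConfiguration m M f) (hl : l ≤ k) :
    IsAConfiguration m M (f ∘ Fin.castLE hl) where
  lagrangian _ := hf.lagrangian _
  transverse _ _ hij := hf.transverse _ _ ((Fin.castLE_injective hl).ne hij)
  adjacent i j := hf.adjacent (Fin.castLE hl i) (Fin.castLE hl j)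
  distant i j := hf.distant (Fin.castLE hl i) (Fin.castLE hl j)

theorem IsAConfiguration.exists_boundedDomain {k : ℕ} {f : Fin k → S2 → Cn 3}
    (hf : IsAConfiguration m (hypersurface m) f) :
    ∃ R₀ : ℝ, ∀ R, R₀ ≤ R → IsAConfiguration m (boundedDomain m R) f := by
  have bounded_sphere (i : Fin k) : Bornology.IsBounded (Set.range (f i)) :=
    (isCompact_range (hf.lagrangian i).smooth.continuous).isBounded
  obtain ⟨R₀, hR₀⟩ := (Bornology.isBounded_iUnion.2 bounded_sphere).subset_ball 0
  refine ⟨R₀, fun R hR => { hf with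
    lagrangian := fun i => { hf.lagrangian i with
      mem := fun t => ⟨?_, (hf.lagrangian i).mem t⟩ } }⟩
  have mem_ball := hR₀ (Set.mem_iUnion.2 ⟨i, Set.mem_range_self t⟩)
  exact (mem_ball_zero_iff.1 mem_ball).trans_le hR

end Configuration

theorem mainTheorem3 (m : ℕ) (hm : 1 ≤ m) :
    IsSymplecticHypersurface m ∧
    IsIsotropicImmersion figureEight ∧
    (∃ F : S2 → Cn 3, (∀ t, F t ∈ hypersurface m ∧ branchedCover (F t) = figureEight t) ∧
      IsAConfiguration m (hypersurface m) (fun (k : Fin m) (t : S2) => (deckMap m)^[k] (F t))) ∧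
    (3 ≤ m → ∃ R₀ : ℝ, ∀ R : ℝ, R₀ ≤ R → SatisfiesKnottingHypotheses m (boundedDomain m R)) := by
  refine ⟨isSymplecticHypersurface m, isIsotropicImmersion_figureEight, exists_configuration m,
    fun three_le => ?_⟩
  obtain ⟨F, -, hF⟩ := exists_configuration m
  obtain ⟨R₁, hR₁⟩ := (hF.comp_castLE three_le).exists_boundedDomain
  refine ⟨max R₁ (m + 1), fun R hR => ?_⟩
  have hmR : (m : ℝ) + 1 ≤ R := (le_max_right _ _).trans hR
  have hm₁ : (1 : ℝ) ≤ m := by exact_mod_cast hm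
  exact
    { contactType := isInteriorOfContactTypeDomain_boundedDomain (by linarith) (by nlinarith)
      configuration := ⟨_, hR₁ R ((le_max_left _ _).trans hR)⟩
      symplecticClass := symplecticClassVanishes m _
      chernClass := firstChernClassVanishes fun _ hz => hz.2 }
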